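/- Let $G$ be a finite connected simple graph. For vertices $u,v$ let $d(u,v)$ be their graph distance, and for an edge $uv$ let $n_u(v)$ be the number of vertices strictly closer to $u$ than to $v$. For $\alpha\in\mathbb R$ put $$W^{\alpha}(G)=\sum_{\{u,v\}} d(u,v)^{\alpha},\qquad \mathrm{Sz}^{\alpha}(G)=\sum_{uv\in E(G)}\bigl(n_u(v)\,n_v(u)\bigr)^{\alpha},$$ the first sum being over all unordered pairs of distinct vertices. Say that $G$ satisfies the strong conjecture if $G$ is complete, or there is a constant $\alpha_G\in(0,1]$ such that $\mathrm{Sz}^{\alpha}(G)>W^{\alpha}(G)$ for all real $\alpha>\alpha_G$, $\mathrm{Sz}^{\alpha}(G)=W^{\alpha}(G)$ for $\alpha=\alpha_G$, and $\mathrm{Sz}^{\alpha}(G)<W^{\alpha}(G)$ for all real $\alpha<\alpha_G$. Let $G(n,p)$ be the random graph on $n$ labelled vertices in which each pair of vertices is an edge independently with probability $p$, and let $G(n,m)$ be a uniformly random graph on $n$ labelled vertices with exactly $m$ edges. **Corollary.** For every sequence $p=p(n)\in(0,1]$, the probability that $G(n,p)$, conditioned on being connected, satisfies the strong conjecture tends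 to $1$ as $n\to\infty$. For every sequence of integers $m=m(n)$ with $n-1\le m(n)\le\binom n2$, the probability that $G(n,m)$, conditioned on being connected, satisfies the strong conjecture tends to $1$ as $n\to\infty$. (The conditions on $p(n)$ and $m(n)$ need only hold for all sufficiently large $n$.) -/

import Mathlib

namespace SimpleGraph

/-- The distance between the two vertices of an unordered pair. -/
noncomputable def pairDist {V : Type*} (G : SimpleGraph V) : Sym2 V → ℕ :=
  Sym2.lift ⟨fun u v => G.dist u v, fun _ _ => G.dist_comm⟩

/-- `n_u(v)`: the number of vertices strictly closer to `u` than to `v`. -/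
noncomputable def numCloser {V : Type*} (G : SimpleGraph V) (u v : V) : ℕ :=
  Set.ncard {w : V | G.dist w u < G.dist w v}

/-- The product `n_u(v) * n_v(u)` attached to an unordered pair `uv`. -/
noncomputable def szegedWeight {V : Type*} (G : SimpleGraph V) : Sym2 V → ℕ :=
  Sym2.lift ⟨fun u v => G.numCloser u v * G.numCloser v u, fun _ _ => Nat.mul_comm _ _⟩

open Classical in
/-- The variable Wiener index `W^α(G)`: the sum of `d(u,v)^α` over all unordered pairs of distinct
vertices. It is meant for connected graphs. -/
noncomputable def variableWiener {V : Type*} [Fintype V] (G : SimpleGraph V) (α : ℝ) : ℝ :=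
  ∑ e : Sym2 V with ¬ e.IsDiag, (G.pairDist e : ℝ) ^ α

open Classical in
/-- The variable Szeged index `Sz^α(G)`: the sum of `(n_u(v) * n_v(u))^α` over all edges `uv`.
It is meant for connected graphs. -/
noncomputable def variableSzeged {V : Type*} [Fintype V] (G : SimpleGraph V) (α : ℝ) : ℝ :=
  ∑ e ∈ G.edgeFinset, (G.szegedWeight e : ℝ) ^ α

/-- The assertion of the strong conjecture for a (connected) graph `G`: if `G` is not complete, there
is a critical exponent in `(0,1]` above which the variable Szeged index is larger, at which the two
indices agree, and below which the variable Wiener index is larger. -/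
def StrongConjectureHolds {V : Type*} [Fintype V] (G : SimpleGraph V) : Prop :=
  G ≠ ⊤ → ∃ a : ℝ, 0 < a ∧ a ≤ 1 ∧ ∀ α : ℝ,
    (a < α → G.variableWiener α < G.variableSzeged α) ∧
    (α = a → G.variableSzeged α = G.variableWiener α) ∧
    (α < a → G.variableSzeged α < G.variableWiener α)

/-- The random graph `G(n,m)`: the uniform distribution on the graphs with vertex set
`{0, …, n - 1}` and exactly `m` edges. -/
noncomputable def uniformRandom (n m : ℕ) : MeasureTheory.Measure (SimpleGraph (Fin n)) :=
  ProbabilityTheory.uniformOn {G : SimpleGraph (Fin n) | G.edgeSet.ncard = m}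

end SimpleGraph

namespace SimpleGraph

section Deterministic

open scoped Classical

variable {V : Type*} [Fintype V] {G : SimpleGraph V}

omit [Fintype V] in
/-- A shortest path, given by its sequence of vertices. -/
lemma Connected.exists_geodesic (hG : G.Connected) (x y : V) :
    ∃ f : ℕ → V, (∀ i ≤ G.dist x y, G.dist x (f i) = i ∧ i + G.dist (f i) y = G.dist x y) ∧
      ∀ i < G.dist x y, G.Adj (f i) (f (i + 1)) := by
  obtain ⟨p, hp⟩ := hG.exists_walk_length_eq_dist x y
  refine ⟨p.getVert, fun i hi => ?_, fun i hi => p.adj_getVert_succ (hp ▸ hi)⟩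
  have h1 : G.dist x (p.getVert i) ≤ i := by
    refine (dist_le (p.take i)).trans ?_
    rw [Walk.take_length]
    exact min_le_left _ _
  have h2 : G.dist (p.getVert i) y ≤ G.dist x y - i := by
    refine (dist_le (p.drop i)).trans ?_
    rw [Walk.drop_length, hp]
  have h3 := hG.dist_triangle (u := x) (v := p.getVert i) (w := y)
  omega

lemma two_mul_sum_sym2 {M : Type*} [CommSemiring M] (S : Finset (Sym2 V))
    (hS : ∀ e ∈ S, ¬ e.IsDiag) (F : Sym2 V → M) :
    2 * ∑ e ∈ S, F e = ∑ q : V × V with s(q.1, q.2) ∈ S, F s(q.1, q.2) := by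
  rw [← Finset.sum_fiberwise_of_maps_to (s := Finset.univ.filter fun q : V × V => s(q.1, q.2) ∈ S)
    (t := S) (g := fun q => s(q.1, q.2)) (by simp), Finset.mul_sum]
  refine Finset.sum_congr rfl fun e he => ?_
  induction e with
  | _ a b =>
    have hab : a ≠ b := by simpa using hS _ he
    have : {q ∈ Finset.univ.filter (fun q : V × V => s(q.1, q.2) ∈ S) | s(q.1, q.2) = s(a, b)}
        = {(a, b), (b, a)} := by
      ext ⟨x, y⟩
      simp only [Finset.mem_filter, Finset.mem_univ, true_and, Sym2.eq_iff, Finset.mem_insert,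
        Finset.mem_singleton, Prod.mk.injEq]
      refine ⟨fun h => h.2, fun h => ⟨?_, h⟩⟩
      rcases h with ⟨rfl, rfl⟩ | ⟨rfl, rfl⟩
      · exact he
      · rwa [Sym2.eq_swap]
    rw [this, Finset.sum_pair (by simp [hab]), Sym2.eq_swap (a := b)]
    ring

lemma two_mul_sum_pairDist :
    2 * ∑ e : Sym2 V with ¬ e.IsDiag, G.pairDist e = ∑ q : V × V, G.dist q.1 q.2 := by
  rw [two_mul_sum_sym2 _ (by simp)]
  simp only [Finset.mem_filter, Finset.mem_univ, true_and, Sym2.mk_isDiag_iff]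
  refine Finset.sum_subset (Finset.subset_univ _) fun q _ hq => ?_
  have : q.1 = q.2 := by simpa using hq
  simp [pairDist, this]

lemma numCloser_eq_card (u v : V) :
    G.numCloser u v = (Finset.univ.filter fun w => G.dist w u < G.dist w v).card := by
  rw [numCloser, ← Set.ncard_coe_finset]
  simp

/-- The Wiener index is at most the Szeged index. -/
lemma Connected.sum_pairDist_le (hG : G.Connected) :
    ∑ e : Sym2 V with ¬ e.IsDiag, G.pairDist e ≤ ∑ e ∈ G.edgeFinset, G.szegedWeight e := by
  refine Nat.le_of_mul_le_mul_left ?_ two_pos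
  rw [two_mul_sum_pairDist, two_mul_sum_sym2 _ fun e he => G.not_isDiag_of_mem_edgeFinset he]
  simp only [mem_edgeFinset, mem_edgeSet]
  set A : Finset (V × V) := Finset.univ.filter fun q => G.Adj q.1 q.2 with hA
  calc ∑ q : V × V, G.dist q.1 q.2
      ≤ ∑ q : V × V, (A.filter fun r => G.dist q.1 r.1 < G.dist q.1 r.2 ∧
          G.dist q.2 r.2 < G.dist q.2 r.1).card := by
        refine Finset.sum_le_sum fun q _ => ?_
        obtain ⟨f, hf, hadj⟩ := hG.exists_geodesic q.1 q.2
        conv_lhs => rw [← Finset.card_range (G.dist q.1 q.2)]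
        refine Finset.card_le_card_of_injOn (fun i => (f i, f (i + 1))) ?_ ?_
        · intro i hi
          have hi : i < G.dist q.1 q.2 := by simpa using hi
          have h1 := hf i hi.le
          have h2 := hf (i + 1) hi
          rw [G.dist_comm (u := f i)] at h1
          rw [G.dist_comm (u := f (i + 1))] at h2
          simp only [hA, Finset.coe_filter, Finset.mem_filter, Finset.mem_univ, true_and,
            Set.mem_ofPred_eq]
          exact ⟨hadj i hi, by omega, by omega⟩
        · intro i hi j hj hij
          have hi : i < G.dist q.1 q.2 := by simpa using hi
          have hj : j < G.dist q.1 q.2 := by simpa using hj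
          have h1 := (hf i hi.le).1
          have h2 := (hf j hj.le).1
          rw [← h1, ← h2, (Prod.mk.inj hij).1]
    _ = ∑ r ∈ A, ∑ q : V × V, if G.dist q.1 r.1 < G.dist q.1 r.2 ∧
          G.dist q.2 r.2 < G.dist q.2 r.1 then 1 else 0 := by
        rw [Finset.sum_comm]
        exact Finset.sum_congr rfl fun q _ => by rw [Finset.card_filter]
    _ = ∑ r ∈ A, G.szegedWeight s(r.1, r.2) := by
        refine Finset.sum_congr rfl fun r _ => ?_
        rw [← Finset.card_filter]
        simp only [szegedWeight, Sym2.lift_mk, numCloser_eq_card]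
        rw [← Finset.card_product]
        congr 1
        ext q
        simp

lemma numCloser_pos {u v : V} (h : G.Adj u v) : 0 < G.numCloser u v := by
  rw [numCloser_eq_card, Finset.card_pos]
  exact ⟨u, by simp [dist_eq_one_iff_adj.2 h]⟩

lemma one_le_szegedWeight {e : Sym2 V} (he : e ∈ G.edgeFinset) : 1 ≤ G.szegedWeight e := by
  induction e with
  | _ a b =>
    have h : G.Adj a b := by simpa using he
    exact Nat.mul_pos (numCloser_pos h) (numCloser_pos h.symm)

lemma pairDist_of_mem {e : Sym2 V} (he : e ∈ G.edgeFinset) : G.pairDist e = 1 := by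
  induction e with
  | _ a b => exact dist_eq_one_iff_adj.2 (by simpa using he)

omit [Fintype V] in
lemma Connected.one_le_pairDist (hG : G.Connected) {e : Sym2 V} (he : ¬ e.IsDiag) :
    1 ≤ G.pairDist e := by
  induction e with
  | _ a b => exact hG.pos_dist_of_ne (by simpa using he)

lemma filter_mem_edgeFinset :
    (Finset.univ.filter fun e : Sym2 V => ¬ e.IsDiag).filter (· ∈ G.edgeFinset)
      = G.edgeFinset := by
  ext e
  simp only [Finset.mem_filter, Finset.mem_univ, true_and, and_iff_right_iff_imp]
  exact fun he => G.not_isDiag_of_mem_edgeFinset he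

lemma variableWiener_eq_add (α : ℝ) :
    G.variableWiener α = G.edgeFinset.card +
      ∑ e ∈ (Finset.univ.filter fun e : Sym2 V => ¬ e.IsDiag) with e ∉ G.edgeFinset,
        (G.pairDist e : ℝ) ^ α := by
  rw [variableWiener, ← Finset.sum_filter_add_sum_filter_not _ (· ∈ G.edgeFinset),
    filter_mem_edgeFinset]
  congr 1
  rw [Finset.sum_congr rfl fun e he => by rw [pairDist_of_mem he]]
  simp

omit [Fintype V] in
lemma exists_not_adj_of_ne_top (hne : G ≠ ⊤) : ∃ a b, a ≠ b ∧ ¬ G.Adj a b := by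
  contrapose! hne
  ext a b
  exact ⟨fun h => h.ne, fun h => hne a b h⟩

lemma Connected.variableSzeged_lt_of_nonpos (hG : G.Connected) (hne : G ≠ ⊤) {α : ℝ}
    (hα : α ≤ 0) : G.variableSzeged α < G.variableWiener α := by
  rw [variableWiener_eq_add]
  have h1 : G.variableSzeged α ≤ G.edgeFinset.card := by
    rw [variableSzeged, Finset.card_eq_sum_ones, Nat.cast_sum]
    refine Finset.sum_le_sum fun e he => ?_
    rw [Nat.cast_one]
    exact Real.rpow_le_one_of_one_le_of_nonpos (by exact_mod_cast one_le_szegedWeight he) hα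
  refine h1.trans_lt (lt_add_of_pos_right _ (Finset.sum_pos (fun e he => ?_) ?_))
  · simp only [Finset.mem_filter, Finset.mem_univ, true_and] at he
    exact Real.rpow_pos_of_pos (by exact_mod_cast hG.one_le_pairDist he.1) _
  · obtain ⟨a, b, hab, hn⟩ := exists_not_adj_of_ne_top hne
    exact ⟨s(a, b), by simp [hab, hn]⟩

/-- If, once the Szeged index has caught up with the Wiener index at an exponent in `(0,1]`, it
stays larger, then the strong conjecture holds. -/
lemma Connected.strongConjectureHolds_of_crossing (hG : G.Connected)
    (h : G ≠ ⊤ → ∀ a b : ℝ, 0 < a → a ≤ 1 → a < b →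
      G.variableWiener a ≤ G.variableSzeged a → G.variableWiener b < G.variableSzeged b) :
    G.StrongConjectureHolds := by
  intro hne
  have h := h hne
  have h1 : G.variableWiener 1 ≤ G.variableSzeged 1 := by
    simp only [variableWiener, variableSzeged, Real.rpow_one]
    exact_mod_cast hG.sum_pairDist_le
  have hcont : ContinuousOn (fun α => G.variableSzeged α - G.variableWiener α)
      (Set.Icc 0 1) := by
    refine Continuous.continuousOn (Continuous.sub ?_ ?_)
    · refine continuous_finsetSum _ fun e he => ?_
      exact Real.continuous_const_rpow (by have := one_le_szegedWeight he; positivity)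
    · refine continuous_finsetSum _ fun e he => ?_
      have := hG.one_le_pairDist (e := e) (by simpa using he)
      exact Real.continuous_const_rpow (by positivity)
  have h0 := hG.variableSzeged_lt_of_nonpos hne le_rfl
  obtain ⟨a, ha, hfa⟩ := intermediate_value_Icc zero_le_one hcont
    (show (0 : ℝ) ∈ Set.Icc _ _ from ⟨by linarith, by linarith⟩)
  have ha0 : 0 < a := by
    rcases ha.1.eq_or_lt with rfl | h'
    · simp only at hfa
      linarith
    · exact h'
  simp only at hfa
  refine ⟨a, ha0, ha.2, fun α => ⟨fun hα => h a α ha0 ha.2 hα (by linarith), ?_, fun hα => ?_⟩⟩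
  · rintro rfl
    linarith
  · rcases le_or_gt α 0 with h' | h'
    · exact hG.variableSzeged_lt_of_nonpos hne h'
    · by_contra! hcon
      have := h α a h' (hα.le.trans ha.2) hα hcon
      linarith

lemma sum_rpow_lt_of_sum_rpow_le {ι κ : Type*} (E : Finset ι) (P : Finset κ) (w : ι → ℝ)
    (d : κ → ℝ) (hw : ∀ e ∈ E, 0 ≤ w e) {T : ℝ} (hT : 0 < T)
    (hd : ∀ e ∈ P, 0 < d e ∧ d e ≤ T) (hP : E.card * T < ∑ e ∈ P, d e) {a b : ℝ} (ha : 0 < a)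
    (ha1 : a ≤ 1) (hab : a < b) (h : ∑ e ∈ P, d e ^ a ≤ ∑ e ∈ E, w e ^ a) :
    ∑ e ∈ P, d e ^ b < ∑ e ∈ E, w e ^ b := by
  have scale : ∀ c : ℝ, (∑ e ∈ P, (d e / T) ^ c = (∑ e ∈ P, d e ^ c) / T ^ c) ∧
      (∑ e ∈ E, (w e / T) ^ c = (∑ e ∈ E, w e ^ c) / T ^ c) := fun c => by
    rw [Finset.sum_div, Finset.sum_div]
    exact ⟨Finset.sum_congr rfl fun e he => Real.div_rpow (hd e he).1.le hT.le _,
      Finset.sum_congr rfl fun e he => Real.div_rpow (hw e he) hT.le _⟩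
  have key : ∑ e ∈ P, (d e / T) ^ b < ∑ e ∈ E, (w e / T) ^ b := by
    have h1 : ∑ e ∈ P, (d e / T) ^ b ≤ ∑ e ∈ P, (d e / T) ^ a :=
      Finset.sum_le_sum fun e he => Real.rpow_le_rpow_of_exponent_ge (div_pos (hd e he).1 hT)
        ((div_le_one hT).2 (hd e he).2) hab.le
    have h2 : ∑ e ∈ P, d e / T ≤ ∑ e ∈ P, (d e / T) ^ a :=
      Finset.sum_le_sum fun e he => by
        conv_lhs => rw [← Real.rpow_one (d e / T)]
        exact Real.rpow_le_rpow_of_exponent_ge (div_pos (hd e he).1 hT)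
          ((div_le_one hT).2 (hd e he).2) ha1
    have h3 : (E.card : ℝ) < ∑ e ∈ P, d e / T := by
      rw [← Finset.sum_div, lt_div_iff₀ hT]
      exact hP
    have h4 : ∑ e ∈ P, (d e / T) ^ a ≤ ∑ e ∈ E, (w e / T) ^ a := by
      rw [(scale a).1, (scale a).2]
      exact div_le_div_of_nonneg_right h (Real.rpow_nonneg hT.le _)
    have h5 : ∑ e ∈ E, (1 + b / a * ((w e / T) ^ a - 1)) ≤ ∑ e ∈ E, (w e / T) ^ b := by
      refine Finset.sum_le_sum fun e he => ?_
      have hx : 0 ≤ w e / T := div_nonneg (hw e he) hT.le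
      have hy := one_add_mul_self_le_rpow_one_add (s := (w e / T) ^ a - 1) (p := b / a)
        (by have := Real.rpow_nonneg hx a; linarith) ((one_le_div ha).2 hab.le)
      rwa [add_sub_cancel, ← Real.rpow_mul hx, mul_div_cancel₀ _ ha.ne'] at hy
    rw [Finset.sum_add_distrib, ← Finset.mul_sum, Finset.sum_sub_distrib] at h5
    simp only [Finset.sum_const, nsmul_eq_mul, mul_one] at h5
    have h6 : 1 < b / a := (one_lt_div ha).2 hab
    nlinarith
  rw [(scale b).1, (scale b).2] at key
  exact (div_lt_div_iff_of_pos_right (Real.rpow_pos_of_pos hT _)).1 key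

/-- The strong conjecture holds if the average distance exceeds the product of the edge density and
the diameter. -/
lemma Connected.strongConjectureHolds_of_lt (hG : G.Connected) {D : ℕ}
    (hD : ∀ u v, G.dist u v ≤ D)
    (h : G.edgeFinset.card * D < ∑ e : Sym2 V with ¬ e.IsDiag, G.pairDist e) :
    G.StrongConjectureHolds := by
  refine hG.strongConjectureHolds_of_crossing fun hne a b ha ha1 hab hle => ?_
  have hD' : ∀ e, G.pairDist e ≤ D := fun e => by
    induction e with
    | _ a b => exact hD a b
  have hD0 : 0 < D := by
    obtain ⟨u, v, huv, -⟩ := exists_not_adj_of_ne_top hne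
    exact (hG.pos_dist_of_ne huv).trans_le (hD u v)
  refine sum_rpow_lt_of_sum_rpow_le _ _ _ _ (fun e _ => by positivity)
    (T := D) (by exact_mod_cast hD0) (fun e he => ⟨?_, by exact_mod_cast hD' e⟩) ?_ ha ha1 hab hle
  · exact_mod_cast hG.one_le_pairDist (by simpa using he)
  · exact_mod_cast h

/-- The strong conjecture holds for graphs of diameter two. -/
lemma Connected.strongConjectureHolds_of_dist_le_two (hG : G.Connected)
    (hD : ∀ u v, G.dist u v ≤ 2) : G.StrongConjectureHolds := by
  refine hG.strongConjectureHolds_of_crossing fun hne a b ha ha1 hab hle => ?_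
  set Q := (Finset.univ.filter fun e : Sym2 V => ¬ e.IsDiag).filter (· ∉ G.edgeFinset) with hQ
  have hW : ∀ c : ℝ, G.variableWiener c = G.edgeFinset.card + Q.card * (2 : ℝ) ^ c := fun c => by
    rw [variableWiener_eq_add, ← nsmul_eq_mul, ← Finset.sum_const]
    congr 1
    refine Finset.sum_congr rfl fun e he => ?_
    simp only [hQ, Finset.mem_filter, Finset.mem_univ, true_and] at he
    have : G.pairDist e = 2 := by
      induction e with
      | _ x y =>
        have h1 := hG.one_lt_dist_of_ne_of_not_adj (u := x) (v := y) (by simpa using he.1)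
          (by simpa using he.2)
        have h2 := hD x y
        change G.dist x y = 2
        omega
    rw [this]
    norm_num
  have hScale : ∀ c : ℝ, (G.variableSzeged c - G.edgeFinset.card) / 2 ^ c =
      ∑ e ∈ G.edgeFinset, (((G.szegedWeight e : ℝ) / 2) ^ c - (1 / 2) ^ c) := fun c => by
    rw [variableSzeged, Finset.card_eq_sum_ones, Nat.cast_sum, ← Finset.sum_sub_distrib,
      Finset.sum_div]
    refine Finset.sum_congr rfl fun e he => ?_
    rw [Real.div_rpow (by positivity) (by norm_num), Real.div_rpow (by norm_num) (by norm_num),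
      Real.one_rpow, sub_div, Nat.cast_one]
  have hterm : ∀ e ∈ G.edgeFinset, (((G.szegedWeight e : ℝ) / 2) ^ a - (1 / 2) ^ a) ≤
      (((G.szegedWeight e : ℝ) / 2) ^ b - (1 / 2) ^ b) ∧ (G.szegedWeight e ≠ 1 →
      (((G.szegedWeight e : ℝ) / 2) ^ a - (1 / 2) ^ a) <
      (((G.szegedWeight e : ℝ) / 2) ^ b - (1 / 2) ^ b)) := by
    intro e he
    have h1 := one_le_szegedWeight he
    by_cases hw : G.szegedWeight e = 1
    · simp [hw]
    · have h2 : (2 : ℝ) ≤ G.szegedWeight e := by exact_mod_cast (by omega : 2 ≤ G.szegedWeight e)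
      have h3 : ((G.szegedWeight e : ℝ) / 2) ^ a ≤ ((G.szegedWeight e : ℝ) / 2) ^ b :=
        Real.rpow_le_rpow_of_exponent_le (by linarith) hab.le
      have h4 : ((1 : ℝ) / 2) ^ b < (1 / 2) ^ a :=
        Real.rpow_lt_rpow_of_exponent_gt (by norm_num) (by norm_num) hab
      exact ⟨by linarith, fun _ => by linarith⟩
  obtain ⟨x, y, hxy, hn⟩ := exists_not_adj_of_ne_top hne
  obtain ⟨f, hf, hadj⟩ := hG.exists_geodesic x y
  have hd : G.dist x y = 2 := by
    have h1 := hG.one_lt_dist_of_ne_of_not_adj hxy hn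
    have h2 := hD x y
    omega
  have hfx : x = f 0 := by
    have := (hf 0 (by omega)).1
    exact hG.dist_eq_zero_iff.1 this
  have h1y := (hf 1 (by omega)).2
  have hedge : G.Adj x (f 1) := by
    conv_lhs => rw [hfx]
    exact hadj 0 (by omega)
  have hbig : G.szegedWeight s(f 1, x) ≠ 1 := by
    have h1 : 2 ≤ G.numCloser (f 1) x := by
      rw [numCloser_eq_card]
      refine Finset.one_lt_card.2 ⟨f 1, ?_, y, ?_, ?_⟩
      · simp [dist_eq_one_iff_adj.2 hedge.symm]
      · simp only [Finset.mem_filter, Finset.mem_univ, true_and]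
        rw [G.dist_comm (u := y), G.dist_comm (u := y), hd]
        omega
      · rintro rfl
        simp at h1y
        omega
    have h2 := numCloser_pos hedge
    change G.numCloser (f 1) x * G.numCloser x (f 1) ≠ 1
    nlinarith
  have hlt : (G.variableSzeged a - G.edgeFinset.card) / 2 ^ a <
      (G.variableSzeged b - G.edgeFinset.card) / 2 ^ b := by
    rw [hScale, hScale]
    have hmem : s(f 1, x) ∈ G.edgeFinset := by simpa using hedge.symm
    exact Finset.sum_lt_sum (fun e he => (hterm e he).1) ⟨_, hmem, (hterm _ hmem).2 hbig⟩
  have ha2 : (0 : ℝ) < 2 ^ a := by positivity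
  have hb2 : (0 : ℝ) < 2 ^ b := by positivity
  have h1 : (Q.card : ℝ) ≤ (G.variableSzeged a - G.edgeFinset.card) / 2 ^ a := by
    rw [le_div_iff₀ ha2]
    have := hW a
    linarith
  have h2 := h1.trans_lt hlt
  rw [lt_div_iff₀ hb2] at h2
  have := hW b
  linarith

lemma sq_le_two_mul_sum_natAbs (D : ℕ) :
    D ^ 2 ≤ 2 * ∑ i ∈ Finset.range (D + 1), ((D : ℤ) - 2 * i).natAbs := by
  induction D using Nat.twoStepInduction with
  | zero => simp
  | one => decide
  | more D ih _ =>
    rw [Finset.sum_range_succ, Finset.sum_range_succ']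
    have : ∀ i ∈ Finset.range (D + 1), (((D + 2 : ℕ) : ℤ) - 2 * ((i + 1 : ℕ) : ℤ)).natAbs =
        ((D : ℤ) - 2 * i).natAbs := fun i _ => by
      congr 1
      push_cast
      ring
    rw [Finset.sum_congr rfl this]
    have h1 : (((D + 2 : ℕ) : ℤ) - 2 * ((0 : ℕ) : ℤ)).natAbs = D + 2 := by simp; omega
    have h2 : (((D + 2 : ℕ) : ℤ) - 2 * ((D + 1 + 1 : ℕ) : ℤ)).natAbs = D + 2 := by
      push_cast; omega
    rw [h1, h2]
    nlinarith

lemma Connected.card_mul_diam_sq_le (hG : G.Connected) :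
    Fintype.card V * G.diam ^ 2 ≤ 8 * ∑ e : Sym2 V with ¬ e.IsDiag, G.pairDist e := by
  have := hG.nonempty
  obtain ⟨x, y, hxy⟩ := G.exists_dist_eq_diam
  obtain ⟨f, hf, -⟩ := hG.exists_geodesic x y
  rw [hxy] at hf
  set D := G.diam
  have key : ∀ z : V, D ^ 2 ≤ 4 * ∑ v : V, G.dist z v := by
    intro z
    have h1 : ∑ i ∈ Finset.range (D + 1), G.dist z (f i) ≤ ∑ v : V, G.dist z v := by
      rw [← Finset.sum_image (f := fun v => G.dist z v) (g := f)]
      · exact Finset.sum_le_sum_of_subset (Finset.subset_univ _)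
      · intro i hi j hj hij
        have hi : i < D + 1 := by simpa using hi
        have hj : j < D + 1 := by simpa using hj
        rw [← (hf i (by omega)).1, ← (hf j (by omega)).1, hij]
    have h2 := Finset.sum_range_reflect (fun i => G.dist z (f i)) (D + 1)
    have h3 : ∑ i ∈ Finset.range (D + 1), ((D : ℤ) - 2 * i).natAbs ≤
        ∑ i ∈ Finset.range (D + 1), (G.dist z (f i) + G.dist z (f (D + 1 - 1 - i))) := by
      refine Finset.sum_le_sum fun i hi => ?_
      have hi : i < D + 1 := by simpa using hi
      have a1 := (hf i (by omega)).1
      have a2 := (hf (D + 1 - 1 - i) (by omega)).1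
      have a3 := hG.dist_triangle (u := x) (v := f i) (w := z)
      have a4 := hG.dist_triangle (u := x) (v := z) (w := f i)
      have a5 := hG.dist_triangle (u := x) (v := f (D + 1 - 1 - i)) (w := z)
      have a6 := hG.dist_triangle (u := x) (v := z) (w := f (D + 1 - 1 - i))
      rw [G.dist_comm (u := f i)] at a3
      rw [G.dist_comm (u := f (D + 1 - 1 - i))] at a5
      omega
    rw [Finset.sum_add_distrib, h2] at h3
    have h4 := sq_le_two_mul_sum_natAbs D
    omega
  have h8 : 8 * ∑ e : Sym2 V with ¬ e.IsDiag, G.pairDist e = 4 * ∑ z : V, ∑ v : V, G.dist z v := by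
    rw [← Fintype.sum_prod_type' (f := fun z v => G.dist z v), ← two_mul_sum_pairDist]
    ring
  rw [h8, Finset.mul_sum, ← smul_eq_mul, ← Finset.card_univ, ← Finset.sum_const]
  exact Finset.sum_le_sum fun z _ => key z

lemma card_not_isDiag :
    (Finset.univ.filter fun e : Sym2 V => ¬ e.IsDiag).card = (Fintype.card V).choose 2 := by
  rw [← Sym2.card_subtype_not_diag, Fintype.card_subtype]

lemma Connected.choose_le_sum_pairDist (hG : G.Connected) :
    (Fintype.card V).choose 2 ≤ ∑ e : Sym2 V with ¬ e.IsDiag, G.pairDist e := by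
  rw [← card_not_isDiag, Finset.card_eq_sum_ones]
  exact Finset.sum_le_sum fun e he => hG.one_le_pairDist (by simpa using he)

/-- The strong conjecture holds for sparse graphs. -/
lemma Connected.strongConjectureHolds_of_sparse (hG : G.Connected)
    (h : 16 * G.edgeFinset.card ^ 2 < Fintype.card V ^ 2 * (Fintype.card V - 1)) :
    G.StrongConjectureHolds := by
  have := hG.nonempty
  refine hG.strongConjectureHolds_of_lt (D := G.diam)
    (fun u v => dist_le_diam (connected_iff_ediam_ne_top.1 hG)) ?_
  have h1 := hG.card_mul_diam_sq_le
  have h2 := hG.choose_le_sum_pairDist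
  set n := Fintype.card V
  set m := G.edgeFinset.card
  set D := G.diam
  set W := ∑ e : Sym2 V with ¬ e.IsDiag, G.pairDist e
  have hn : 0 < n := Fintype.card_pos
  have h3 : n * (n - 1) ≤ 2 * W := by
    have := Nat.div_two_mul_two_of_even (Nat.even_mul_pred_self n)
    rw [Nat.choose_two_right] at h2
    omega
  rcases le_or_gt (n * D) (8 * m) with hc | hc
  · have : n * (2 * (m * D)) < n * (n * (n - 1)) := by nlinarith
    have := Nat.lt_of_mul_lt_mul_left this
    omega
  · have h4 : 8 * (m * D) < 8 * W := by
      have hD : 0 < D := Nat.pos_of_ne_zero fun h0 => by simp [h0] at hc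
      nlinarith
    omega

end Deterministic

section Counting

lemma choose_mul_pow_le_of_lt {N m k : ℕ} (hm : m ≤ N) (hk : k < m) :
    N.choose k * m ^ k * (N - m) ^ (N - k) ≤
      N.choose (k + 1) * m ^ (k + 1) * (N - m) ^ (N - (k + 1)) := by
  have h1 : N.choose k * (N - m) ≤ N.choose (k + 1) * m := by
    refine Nat.le_of_mul_le_mul_right ?_ (Nat.succ_pos k)
    calc N.choose k * (N - m) * (k + 1) ≤ N.choose k * (N - k) * m := by
          rw [mul_assoc, mul_assoc]
          exact Nat.mul_le_mul_left _ (Nat.mul_le_mul (by omega) hk)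
      _ = N.choose (k + 1) * m * (k + 1) := by
          rw [← Nat.choose_succ_right_eq]
          ring
  rw [show N - k = N - (k + 1) + 1 by omega, pow_succ, pow_succ]
  calc _ = N.choose k * (N - m) * (m ^ k * (N - m) ^ (N - (k + 1))) := by ring
    _ ≤ N.choose (k + 1) * m * (m ^ k * (N - m) ^ (N - (k + 1))) := Nat.mul_le_mul_right _ h1
    _ = _ := by ring

lemma choose_mul_pow_le_of_ge {N m k : ℕ} (hk : m ≤ k) (hkN : k < N) :
    N.choose (k + 1) * m ^ (k + 1) * (N - m) ^ (N - (k + 1)) ≤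
      N.choose k * m ^ k * (N - m) ^ (N - k) := by
  have h1 : N.choose (k + 1) * m ≤ N.choose k * (N - m) := by
    refine Nat.le_of_mul_le_mul_right ?_ (Nat.succ_pos k)
    calc N.choose (k + 1) * m * (k + 1) = N.choose k * (N - k) * m := by
          rw [← Nat.choose_succ_right_eq]
          ring
      _ ≤ N.choose k * (N - m) * (k + 1) := by
          rw [mul_assoc, mul_assoc]
          exact Nat.mul_le_mul_left _ (Nat.mul_le_mul (by omega) (by omega))
  rw [show N - k = N - (k + 1) + 1 by omega, pow_succ, pow_succ]
  calc _ = N.choose (k + 1) * m * (m ^ k * (N - m) ^ (N - (k + 1))) := by ring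
    _ ≤ N.choose k * (N - m) * (m ^ k * (N - m) ^ (N - (k + 1))) := Nat.mul_le_mul_right _ h1
    _ = _ := by ring

/-- The mode of a binomial distribution with integer mean is its mean. -/
lemma choose_mul_pow_le_mode {N m : ℕ} (hm : m ≤ N) {k : ℕ} (hk : k ≤ N) :
    N.choose k * m ^ k * (N - m) ^ (N - k) ≤ N.choose m * m ^ m * (N - m) ^ (N - m) := by
  rcases le_total k m with h | h
  · induction h using Nat.decreasingInduction with
    | self => exact le_rfl
    | of_succ j hj ih => exact (choose_mul_pow_le_of_lt hm hj).trans (ih (by omega))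
  · induction k, h using Nat.le_induction with
    | base => exact le_rfl
    | succ j hj ih => exact (choose_mul_pow_le_of_ge hj (by omega)).trans (ih (by omega))

lemma pow_self_le_mul_mode {N m : ℕ} (hm : m ≤ N) :
    N ^ N ≤ (N + 1) * (N.choose m * m ^ m * (N - m) ^ (N - m)) := by
  calc N ^ N = (m + (N - m)) ^ N := by rw [Nat.add_sub_cancel' hm]
    _ = ∑ k ∈ Finset.range (N + 1), N.choose k * m ^ k * (N - m) ^ (N - k) := by
        rw [add_pow]
        exact Finset.sum_congr rfl fun k _ => by rw [Nat.cast_id]; ring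
    _ ≤ ∑ k ∈ Finset.range (N + 1), N.choose m * m ^ m * (N - m) ^ (N - m) :=
        Finset.sum_le_sum fun k hk =>
          choose_mul_pow_le_mode hm (Nat.lt_succ_iff.1 (Finset.mem_range.1 hk))
    _ = _ := by simp

lemma one_le_mul_binomial_mode {N m : ℕ} (hN : 0 < N) (hm : m ≤ N) :
    (1 : ℝ) ≤ (N + 1) * N.choose m * ((m / N : ℝ) ^ m * (1 - m / N) ^ (N - m)) := by
  have h := pow_self_le_mul_mode hm
  have h' : (N : ℝ) ^ N ≤ (N + 1) * (N.choose m * m ^ m * (N - m : ℝ) ^ (N - m)) := by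
    rw [← Nat.cast_sub hm]
    exact_mod_cast h
  have hN' : (0 : ℝ) < N := by exact_mod_cast hN
  have e1 : (1 - m / N : ℝ) = (N - m) / N := by field_simp
  have e2 : (N : ℝ) ^ N = N ^ m * N ^ (N - m) := by rw [← pow_add, Nat.add_sub_cancel' hm]
  rw [e1, div_pow, div_pow, div_mul_div_comm, ← e2, ← mul_div_assoc, le_div_iff₀ (by positivity)]
  linarith

end Counting

section Weights

open scoped Classical

variable {V : Type*} [Fintype V]

/-- The probability of a graph in the binomial model with edge probability `p`. -/
noncomputable def graphWeight (p : ℝ) (G : SimpleGraph V) : ℝ :=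
  p ^ G.edgeFinset.card * (1 - p) ^ ((Fintype.card V).choose 2 - G.edgeFinset.card)

/-- The probability of an event in the binomial model with edge probability `p`. -/
noncomputable def graphProb (p : ℝ) (Q : SimpleGraph V → Prop) : ℝ :=
  ∑ G with Q G, graphWeight p G

lemma graphWeight_nonneg {p : ℝ} (h0 : 0 ≤ p) (h1 : p ≤ 1) (G : SimpleGraph V) :
    0 ≤ graphWeight p G :=
  mul_nonneg (pow_nonneg h0 _) (pow_nonneg (by linarith) _)

lemma graphProb_nonneg {p : ℝ} (h0 : 0 ≤ p) (h1 : p ≤ 1) (Q : SimpleGraph V → Prop) :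
    0 ≤ graphProb p Q :=
  Finset.sum_nonneg fun G _ => graphWeight_nonneg h0 h1 G

lemma graphProb_le_sum {ι : Type*} {p : ℝ} (h0 : 0 ≤ p) (h1 : p ≤ 1) {Q : SimpleGraph V → Prop}
    (I : Finset ι) (R : ι → SimpleGraph V → Prop) (h : ∀ G, Q G → ∃ i ∈ I, R i G) :
    graphProb p Q ≤ ∑ i ∈ I, graphProb p (R i) := by
  simp only [graphProb, Finset.sum_filter]
  rw [Finset.sum_comm]
  refine Finset.sum_le_sum fun G _ => ?_
  have hnn : ∀ i ∈ I, 0 ≤ if R i G then graphWeight p G else 0 := fun i _ => by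
    split_ifs
    · exact graphWeight_nonneg h0 h1 G
    · exact le_rfl
  split_ifs with hQ
  · obtain ⟨i, hi, hR⟩ := h G hQ
    refine le_trans ?_ (Finset.single_le_sum hnn hi)
    rw [if_pos hR]
  · exact Finset.sum_nonneg hnn

lemma edgeFinset_subset_not_isDiag (G : SimpleGraph V) :
    G.edgeFinset ⊆ Finset.univ.filter fun e : Sym2 V => ¬ e.IsDiag := fun e he => by
  simpa using G.not_isDiag_of_mem_edgeFinset he

lemma card_edgeFinset_le_choose (G : SimpleGraph V) :
    G.edgeFinset.card ≤ (Fintype.card V).choose 2 := by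
  rw [← card_not_isDiag]
  exact Finset.card_le_card G.edgeFinset_subset_not_isDiag

/-- The number of graphs with `m` edges in a family, compared to the probability of the family in
the binomial model. -/
lemma card_le_mul_graphProb (Q : SimpleGraph V → Prop) {m : ℕ}
    (hN : 0 < (Fintype.card V).choose 2) (hm : m ≤ (Fintype.card V).choose 2) :
    ((Finset.univ.filter fun G : SimpleGraph V => G.edgeFinset.card = m ∧ Q G).card : ℝ) ≤
      ((Fintype.card V).choose 2 + 1) * ((Fintype.card V).choose 2).choose m *
        graphProb (m / (Fintype.card V).choose 2) Q := by
  set N := (Fintype.card V).choose 2 with hNdef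
  have hN' : (0 : ℝ) < N := by exact_mod_cast hN
  have h0 : (0 : ℝ) ≤ m / N := by positivity
  have h1 : (m : ℝ) / N ≤ 1 := (div_le_one hN').2 (by exact_mod_cast hm)
  set F := Finset.univ.filter fun G : SimpleGraph V => G.edgeFinset.card = m ∧ Q G with hF
  have h2 : F.card * ((m / N : ℝ) ^ m * (1 - m / N) ^ (N - m)) ≤ graphProb (m / N) Q := by
    rw [← nsmul_eq_mul, ← Finset.sum_const, graphProb]
    calc _ = ∑ G ∈ F, graphWeight (m / N) G := by
          refine Finset.sum_congr rfl fun G hG => ?_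
          rw [graphWeight, (Finset.mem_filter.1 hG).2.1]
      _ ≤ _ := Finset.sum_le_sum_of_subset_of_nonneg
          (fun G hG => by simpa using (Finset.mem_filter.1 hG).2.2)
          fun G _ _ => graphWeight_nonneg h0 h1 G
  have h3 := one_le_mul_binomial_mode hN hm
  calc (F.card : ℝ) = F.card * 1 := by ring
    _ ≤ F.card * ((N + 1) * N.choose m * ((m / N : ℝ) ^ m * (1 - m / N) ^ (N - m))) :=
        mul_le_mul_of_nonneg_left h3 (Nat.cast_nonneg _)
    _ = (N + 1) * N.choose m * (F.card * ((m / N : ℝ) ^ m * (1 - m / N) ^ (N - m))) := by ring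
    _ ≤ _ := mul_le_mul_of_nonneg_left h2 (by positivity)

lemma graphProb_subset_disjoint_le {p : ℝ} (h0 : 0 ≤ p) (h1 : p ≤ 1) {K R : Finset (Sym2 V)}
    (hK : ∀ e ∈ K, ¬ e.IsDiag) (hR : ∀ e ∈ R, ¬ e.IsDiag) (hKR : Disjoint K R) :
    graphProb p (fun G => K ⊆ G.edgeFinset ∧ Disjoint R G.edgeFinset) ≤
      p ^ K.card * (1 - p) ^ R.card := by
  set U := Finset.univ.filter fun e : Sym2 V => ¬ e.IsDiag with hU
  set f : Sym2 V → ℝ := fun e => if e ∈ R then 0 else p with hf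
  set g : Sym2 V → ℝ := fun e => if e ∈ K then 0 else 1 - p with hg
  have hfn : ∀ e, 0 ≤ f e := fun e => by simp only [hf]; split_ifs <;> linarith
  have hgn : ∀ e, 0 ≤ g e := fun e => by simp only [hg]; split_ifs <;> linarith
  have hprod : ∏ e ∈ U, (f e + g e) = p ^ K.card * (1 - p) ^ R.card := by
    have : ∀ e ∈ U, f e + g e = (if e ∈ K then p else 1) * (if e ∈ R then 1 - p else 1) := by
      intro e _
      simp only [hf, hg]
      by_cases h : e ∈ K
      · simp [h, Finset.disjoint_left.1 hKR h]
      · by_cases h' : e ∈ R <;> simp [h, h']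
    have hKU : U.filter (· ∈ K) = K := by
      ext e
      simpa [hU] using hK e
    have hRU : U.filter (· ∈ R) = R := by
      ext e
      simpa [hU] using hR e
    rw [Finset.prod_congr rfl this, Finset.prod_mul_distrib, ← Finset.prod_filter,
      ← Finset.prod_filter, hKU, hRU, Finset.prod_const, Finset.prod_const]
  rw [← hprod, Finset.prod_add]
  set A := Finset.univ.filter fun G : SimpleGraph V =>
    K ⊆ G.edgeFinset ∧ Disjoint R G.edgeFinset with hA
  calc graphProb p (fun G => K ⊆ G.edgeFinset ∧ Disjoint R G.edgeFinset)
      = ∑ G ∈ A, graphWeight p G :=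
        Finset.sum_congr (by ext; simp [hA]) fun _ _ => rfl
    _ = ∑ G ∈ A, (∏ e ∈ G.edgeFinset, f e) * ∏ e ∈ U \ G.edgeFinset, g e := by
        refine Finset.sum_congr rfl fun G hG => ?_
        obtain ⟨hG1, hG2⟩ : K ⊆ G.edgeFinset ∧ Disjoint R G.edgeFinset := by simpa [hA] using hG
        rw [Finset.prod_congr rfl (g := fun _ => p) fun e he => if_neg
            fun h => Finset.disjoint_left.1 hG2 h he,
          Finset.prod_congr (s₁ := U \ G.edgeFinset) rfl (g := fun _ => 1 - p) fun e he => if_neg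
            fun h => (Finset.mem_sdiff.1 he).2 (hG1 h),
          Finset.prod_const, Finset.prod_const,
          Finset.card_sdiff_of_subset G.edgeFinset_subset_not_isDiag, card_not_isDiag, graphWeight]
    _ = ∑ E ∈ A.image fun G => G.edgeFinset, (∏ e ∈ E, f e) * ∏ e ∈ U \ E, g e := by
        rw [Finset.sum_image]
        intro G _ H _ h
        exact edgeFinset_inj.1 h
    _ ≤ ∑ E ∈ U.powerset, (∏ e ∈ E, f e) * ∏ e ∈ U \ E, g e := by
        refine Finset.sum_le_sum_of_subset_of_nonneg (fun E hE => ?_) fun E _ _ =>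
          mul_nonneg (Finset.prod_nonneg fun e _ => hfn e) (Finset.prod_nonneg fun e _ => hgn e)
        obtain ⟨G, -, rfl⟩ := Finset.mem_image.1 hE
        exact Finset.mem_powerset.2 G.edgeFinset_subset_not_isDiag

/-- The probability that two given vertices have no common neighbour. -/
lemma graphProb_no_common_neighbor_le {p : ℝ} (h0 : 0 ≤ p) (h1 : p ≤ 1) {u v : V} (huv : u ≠ v) :
    graphProb p (fun G => ∀ w, ¬ (G.Adj u w ∧ G.Adj v w)) ≤
      (1 - p ^ 2) ^ (Fintype.card V - 2) := by
  set W : Finset V := Finset.univ \ {u, v} with hW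
  have hWm : ∀ w, w ∈ W ↔ w ≠ u ∧ w ≠ v := fun w => by simp [hW]
  have hWc : W.card = Fintype.card V - 2 := by
    rw [hW, Finset.card_sdiff_of_subset (Finset.subset_univ _), Finset.card_pair huv,
      Finset.card_univ]
  have hinj : ∀ x : V, Function.Injective fun w => s(x, w) := fun x a b h => Sym2.congr_right.1 h
  refine (graphProb_le_sum h0 h1 W.powerset
    (fun A G => A.image (fun w => s(u, w)) ⊆ G.edgeFinset ∧
      Disjoint ((W \ A).image (fun w => s(u, w)) ∪ A.image (fun w => s(v, w))) G.edgeFinset)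
    fun G hG => ?_).trans ?_
  · refine ⟨W.filter fun w => G.Adj u w, by simp, ?_, ?_⟩
    · intro e he
      simp only [Finset.mem_image, Finset.mem_filter] at he
      obtain ⟨w, ⟨-, hw⟩, rfl⟩ := he
      simpa using hw
    · rw [Finset.disjoint_left]
      intro e he
      simp only [Finset.mem_union, Finset.mem_image, Finset.mem_filter, Finset.mem_sdiff] at he
      rcases he with ⟨w, ⟨hw, hn⟩, rfl⟩ | ⟨w, ⟨hw, hn⟩, rfl⟩
      · simpa using fun h => hn ⟨hw, h⟩
      · simpa using fun h => hG w ⟨hn, h⟩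
  · have hA : ∀ A ∈ W.powerset, graphProb p (fun G => A.image (fun w => s(u, w)) ⊆ G.edgeFinset ∧
        Disjoint ((W \ A).image (fun w => s(u, w)) ∪ A.image (fun w => s(v, w))) G.edgeFinset)
        ≤ p ^ A.card * 1 ^ (W.card - A.card) * (1 - p) ^ W.card := fun A hA => by
      have hAW := Finset.mem_powerset.1 hA
      have hne : ∀ w ∈ W, ∀ w' ∈ W, s(u, w) ≠ s(v, w') := fun w hw w' hw' h => by
        have := (hWm w').1 hw'
        rcases Sym2.eq_iff.1 h with h | h
        · exact huv h.1
        · exact this.1 h.1.symm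
      refine (graphProb_subset_disjoint_le h0 h1 ?_ ?_ ?_).trans_eq ?_
      · intro e he
        obtain ⟨w, hw, rfl⟩ := Finset.mem_image.1 he
        simpa using ((hWm w).1 (hAW hw)).1.symm
      · intro e he
        rcases Finset.mem_union.1 he with he | he
        · obtain ⟨w, hw, rfl⟩ := Finset.mem_image.1 he
          simpa using ((hWm w).1 (Finset.mem_sdiff.1 hw).1).1.symm
        · obtain ⟨w, hw, rfl⟩ := Finset.mem_image.1 he
          simpa using ((hWm w).1 (hAW hw)).2.symm
      · rw [Finset.disjoint_union_right]
        constructor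
        · rw [Finset.disjoint_image (hinj u)]
          exact Finset.disjoint_sdiff
        · rw [Finset.disjoint_left]
          intro e he he'
          obtain ⟨w, hw, rfl⟩ := Finset.mem_image.1 he
          obtain ⟨w', hw', h⟩ := Finset.mem_image.1 he'
          exact hne w (hAW hw) w' (hAW hw') h.symm
      · rw [Finset.card_union_of_disjoint, Finset.card_image_of_injective _ (hinj u),
          Finset.card_image_of_injective _ (hinj u), Finset.card_image_of_injective _ (hinj v),
          Finset.card_sdiff_add_card_eq_card hAW, one_pow, mul_one]
        rw [Finset.disjoint_left]
        intro e he he'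
        obtain ⟨w, hw, rfl⟩ := Finset.mem_image.1 he
        obtain ⟨w', hw', h⟩ := Finset.mem_image.1 he'
        exact hne w (Finset.mem_sdiff.1 hw).1 w' (hAW hw') h.symm
    refine (Finset.sum_le_sum hA).trans_eq ?_
    rw [← Finset.sum_mul, Finset.sum_pow_mul_eq_add_pow, hWc, ← mul_pow]
    ring

/-- The probability that there is no edge between `A` and the complement of `S`. -/
lemma graphProb_no_edge_le {p : ℝ} (h0 : 0 ≤ p) (h1 : p ≤ 1) {A S : Finset V} (hAS : A ⊆ S) :
    graphProb p (fun G => ∀ x ∈ A, ∀ y, G.Adj x y → y ∈ S) ≤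
      (1 - p) ^ (A.card * (Fintype.card V - S.card)) := by
  set R := (A ×ˢ Sᶜ).image fun q => s(q.1, q.2) with hR
  have hRc : R.card = A.card * (Fintype.card V - S.card) := by
    rw [hR, Finset.card_image_of_injOn, Finset.card_product, Finset.card_compl]
    rintro ⟨a, b⟩ hab ⟨c, d⟩ hcd h
    simp only [Finset.coe_product, Set.mem_prod, Finset.mem_coe, Finset.mem_compl] at hab hcd
    rcases Sym2.eq_iff.1 h with h | h
    · exact Prod.ext h.1 h.2
    · exact absurd (hAS (show d ∈ A from (show a = d from h.1) ▸ hab.1)) hcd.2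
  have key := graphProb_subset_disjoint_le (K := ∅) (R := R) h0 h1 (by simp) (by
    intro e he
    obtain ⟨q, hq, rfl⟩ := Finset.mem_image.1 he
    rw [Finset.mem_product, Finset.mem_compl] at hq
    rw [Sym2.mk_isDiag_iff]
    exact fun h => hq.2 (h ▸ hAS hq.1)) (by simp)
  rw [hRc, Finset.card_empty, pow_zero, one_mul] at key
  refine le_trans ?_ key
  refine Finset.sum_le_sum_of_subset_of_nonneg ?_ fun G _ _ => graphWeight_nonneg h0 h1 G
  intro G hG
  simp only [Finset.mem_filter, Finset.mem_univ, true_and, Finset.empty_subset] at hG ⊢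
  rw [Finset.disjoint_left]
  intro e he hadj
  obtain ⟨q, hq, rfl⟩ := Finset.mem_image.1 he
  rw [Finset.mem_product, Finset.mem_compl] at hq
  exact hq.2 (hG _ hq.1 _ (by simpa using hadj))

/-- A set of vertices expands badly if its closed neighbourhood is contained in a set of at most
half of the vertices that is at most `t` times as large. -/
def HasBadSet (t : ℕ) (G : SimpleGraph V) : Prop :=
  ∃ A S : Finset V, A.Nonempty ∧ A ⊆ S ∧ S.card ≤ t * A.card ∧ 2 * S.card ≤ Fintype.card V ∧
    ∀ x ∈ A, ∀ y, G.Adj x y → y ∈ S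

lemma graphProb_hasBadSet_le {p : ℝ} (h0 : 0 ≤ p) (h1 : p ≤ 1) {t : ℕ}
    (hz : (Fintype.card V : ℝ) ^ (t + 1) * Real.exp (-(p * Fintype.card V / 2)) ≤ 1) :
    graphProb p (HasBadSet t : SimpleGraph V → Prop) ≤
      Fintype.card V * ((Fintype.card V : ℝ) ^ (t + 1) *
        Real.exp (-(p * Fintype.card V / 2))) := by
  set n := Fintype.card V with hn
  set z := (n : ℝ) ^ (t + 1) * Real.exp (-(p * n / 2)) with hzdef
  have hz0 : 0 ≤ z := by positivity
  refine (graphProb_le_sum h0 h1 ((Finset.Icc 1 n).sigma fun a =>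
      Finset.univ.powersetCard a ×ˢ Finset.univ.powersetCard (min (t * a) (n / 2)))
    (fun i G => i.2.1 ⊆ i.2.2 ∧ ∀ x ∈ i.2.1, ∀ y, G.Adj x y → y ∈ i.2.2) fun G hG => ?_).trans ?_
  · obtain ⟨A, S, hA, hAS, hS1, hS2, hadj⟩ := hG
    obtain ⟨T, hST, -, hT⟩ := Finset.exists_subsuperset_card_eq (Finset.subset_univ S)
      (n := min (t * A.card) (n / 2)) (by omega) (by rw [Finset.card_univ]; omega)
    refine ⟨⟨A.card, A, T⟩, ?_, hAS.trans hST, fun x hx y hxy => hST (hadj x hx y hxy)⟩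
    have := hA.card_pos
    have := Finset.card_le_univ A
    simp only [Finset.mem_sigma, Finset.mem_Icc, Finset.mem_product, Finset.mem_powersetCard,
      Finset.subset_univ, hT, and_true]
    omega
  · rw [Finset.sum_sigma]
    have hterm : ∀ a ∈ Finset.Icc 1 n, ∑ q ∈ Finset.univ.powersetCard a ×ˢ
        Finset.univ.powersetCard (min (t * a) (n / 2)), graphProb p (fun G : SimpleGraph V =>
          q.1 ⊆ q.2 ∧ ∀ x ∈ q.1, ∀ y, G.Adj x y → y ∈ q.2) ≤ z := by
      intro a ha
      have ha := Finset.mem_Icc.1 ha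
      have hn1 : 1 ≤ n := ha.1.trans ha.2
      have hq : ∀ q ∈ Finset.univ.powersetCard a ×ˢ
          Finset.univ.powersetCard (min (t * a) (n / 2)), graphProb p (fun G : SimpleGraph V =>
          q.1 ⊆ q.2 ∧ ∀ x ∈ q.1, ∀ y, G.Adj x y → y ∈ q.2) ≤
            Real.exp (-(p * n / 2)) ^ a := by
        intro q hq
        simp only [Finset.mem_product, Finset.mem_powersetCard, Finset.subset_univ,
          true_and] at hq
        by_cases hs : q.1 ⊆ q.2
        · simp only [hs, true_and]
          refine (graphProb_no_edge_le h0 h1 hs).trans ?_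
          rw [hq.1, hq.2, mul_comm a, pow_mul]
          refine pow_le_pow_left₀ (pow_nonneg (by linarith) _) ?_ _
          calc (1 - p) ^ (n - min (t * a) (n / 2))
              ≤ Real.exp (-p) ^ (n - min (t * a) (n / 2)) :=
                pow_le_pow_left₀ (by linarith) (Real.one_sub_le_exp_neg p) _
            _ = Real.exp (-(p * (n - min (t * a) (n / 2) : ℕ))) := by
                rw [← Real.exp_nat_mul]
                ring_nf
            _ ≤ _ := by
                refine Real.exp_le_exp.2 (neg_le_neg ?_)
                rw [mul_div_assoc]
                refine mul_le_mul_of_nonneg_left ?_ h0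
                rw [div_le_iff₀ two_pos]
                exact_mod_cast (by omega : n ≤ (n - min (t * a) (n / 2)) * 2)
        · simp only [hs, false_and]
          simp only [graphProb, Finset.filter_false, Finset.sum_empty]
          positivity
      refine (Finset.sum_le_card_nsmul _ _ _ hq).trans ?_
      rw [Finset.card_product, Finset.card_powersetCard, Finset.card_powersetCard,
        Finset.card_univ, ← hn, nsmul_eq_mul]
      calc ((n.choose a * n.choose (min (t * a) (n / 2)) : ℕ) : ℝ) * Real.exp (-(p * n / 2)) ^ a
          ≤ ((n ^ (t + 1)) ^ a : ℕ) * Real.exp (-(p * n / 2)) ^ a := by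
            refine mul_le_mul_of_nonneg_right ?_ (by positivity)
            refine Nat.cast_le.2 ?_
            calc n.choose a * n.choose (min (t * a) (n / 2)) ≤ n ^ a * n ^ (t * a) :=
                  Nat.mul_le_mul (Nat.choose_le_pow _ _)
                    ((Nat.choose_le_pow _ _).trans (Nat.pow_le_pow_right hn1 (min_le_left _ _)))
              _ = (n ^ (t + 1)) ^ a := by rw [← pow_add, ← pow_mul]; ring_nf
        _ = z ^ a := by
            rw [hzdef, mul_pow]
            push_cast
            rfl
        _ ≤ z := pow_le_of_le_one hz0 hz (by omega)
    refine (Finset.sum_le_card_nsmul _ _ _ hterm).trans ?_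
    simp

end Weights

section Expansion

open scoped Classical

variable {V : Type*} [Fintype V] {G : SimpleGraph V}

/-- In a graph all of whose vertex sets expand well, more than half of the vertices can be reached
from a given vertex by short walks. -/
lemma exists_many_close_of_not_hasBadSet {t : ℕ} (h : ¬ G.HasBadSet t) (v : V) (r : ℕ) :
    ∃ B : Finset V, (∀ x ∈ B, ∃ p : G.Walk v x, p.length ≤ r) ∧ B.Nonempty ∧
      (t ^ r ≤ B.card ∨ Fintype.card V < 2 * B.card) := by
  induction r with
  | zero =>
    refine ⟨{v}, fun x hx => ?_, by simp, by simp⟩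
    obtain rfl := Finset.mem_singleton.1 hx
    exact ⟨Walk.nil, le_rfl⟩
  | succ r ih =>
    obtain ⟨B, hB, hne, hcard⟩ := ih
    set S := B ∪ Finset.univ.filter (fun y => ∃ x ∈ B, G.Adj x y) with hS
    have hBS : B ⊆ S := Finset.subset_union_left
    refine ⟨S, fun y hy => ?_, hne.mono hBS, ?_⟩
    · rcases Finset.mem_union.1 hy with hy | hy
      · obtain ⟨p, hp⟩ := hB y hy
        exact ⟨p, by omega⟩
      · obtain ⟨x, hx, hxy⟩ := (Finset.mem_filter.1 hy).2
        obtain ⟨p, hp⟩ := hB x hx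
        refine ⟨p.concat hxy, ?_⟩
        rw [Walk.length_concat]
        omega
    · by_contra! hcon
      have hle := Finset.card_le_card hBS
      refine h ⟨B, S, hne, hBS, ?_, hcon.2, fun x hx y hxy => ?_⟩
      · refine hcon.1.le.trans ?_
        rw [pow_succ, mul_comm]
        exact Nat.mul_le_mul_left _ (hcard.resolve_right (by omega))
      · exact Finset.mem_union_right _ (by simpa using ⟨x, hx, hxy⟩)

lemma exists_walk_of_not_hasBadSet {t r : ℕ} (h : ¬ G.HasBadSet t)
    (ht : Fintype.card V ≤ t ^ r) (u v : V) : ∃ p : G.Walk u v, p.length ≤ 2 * r := by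
  have hV : 0 < Fintype.card V := Fintype.card_pos_iff.2 ⟨u⟩
  obtain ⟨B, hB, -, hBc⟩ := exists_many_close_of_not_hasBadSet h u r
  obtain ⟨C, hC, -, hCc⟩ := exists_many_close_of_not_hasBadSet h v r
  have hnd : ¬ Disjoint B C := fun hd => by
    have h1 := Finset.card_union_of_disjoint hd
    have h2 := Finset.card_le_univ (B ∪ C)
    omega
  obtain ⟨x, hx, hx'⟩ := Finset.not_disjoint_iff.1 hnd
  obtain ⟨p, hp⟩ := hB x hx
  obtain ⟨q, hq⟩ := hC x hx'
  refine ⟨p.append q.reverse, ?_⟩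
  rw [Walk.length_append, Walk.length_reverse]
  omega

lemma connected_of_not_hasBadSet [Nonempty V] {t r : ℕ} (h : ¬ G.HasBadSet t)
    (ht : Fintype.card V ≤ t ^ r) : G.Connected :=
  (connected_iff G).2 ⟨fun u v => (exists_walk_of_not_hasBadSet h ht u v).choose.reachable, ‹_›⟩

lemma strongConjectureHolds_of_not_hasBadSet [Nonempty V] {t : ℕ} (h : ¬ G.HasBadSet t)
    (ht : Fintype.card V ≤ t ^ 4) (hm : G.edgeFinset.card * 8 < (Fintype.card V).choose 2) :
    G.StrongConjectureHolds := by
  have hG := connected_of_not_hasBadSet h ht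
  refine hG.strongConjectureHolds_of_lt (D := 8) (fun u v => ?_)
    (hm.trans_le hG.choose_le_sum_pairDist)
  obtain ⟨p, hp⟩ := exists_walk_of_not_hasBadSet h ht u v
  exact (dist_le p).trans hp

lemma strongConjectureHolds_of_common_neighbors (hG : G.Connected)
    (h : ∀ u v, u ≠ v → ∃ w, G.Adj u w ∧ G.Adj v w) : G.StrongConjectureHolds := by
  refine hG.strongConjectureHolds_of_dist_le_two fun u v => ?_
  by_cases huv : u = v
  · simp [huv]
  · obtain ⟨w, hu, hv⟩ := h u v huv
    exact dist_le (Walk.cons hu (Walk.cons hv.symm Walk.nil))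

end Expansion

section Asymptotics

open Filter

lemma le_sqrt_sqrt_add_one_pow_four (n : ℕ) : n ≤ (n.sqrt.sqrt + 1) ^ 4 := by
  have h1 := Nat.sqrt_lt'.1 (Nat.lt_succ_self n.sqrt)
  have h2 := Nat.sqrt_lt'.1 (Nat.lt_succ_self n.sqrt.sqrt)
  calc n ≤ (n.sqrt + 1) ^ 2 := h1.le
    _ ≤ ((n.sqrt.sqrt + 1) ^ 2) ^ 2 := Nat.pow_le_pow_left h2 2
    _ = _ := by ring

lemma tendsto_pow_sqrt_sqrt_mul_exp :
    Tendsto (fun n : ℕ => (n : ℝ) ^ (n.sqrt.sqrt + 6) * Real.exp (-(√((n : ℝ) - 1) / 4)))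
      atTop (nhds 0) := by
  have hy : Tendsto (fun n : ℕ => (n : ℝ) ^ (1 / 8 : ℝ)) atTop atTop :=
    (tendsto_rpow_atTop (by norm_num)).comp tendsto_natCast_atTop_atTop
  refine squeeze_zero' (Eventually.of_forall fun n => by positivity) ?_
    (Real.tendsto_exp_neg_atTop_nhds_zero.comp hy)
  filter_upwards [hy.eventually_ge_atTop 100, eventually_ge_atTop 2] with n hn hn2
  set y := (n : ℝ) ^ (1 / 8 : ℝ) with hydef
  have hn2' : (2 : ℝ) ≤ n := by exact_mod_cast hn2
  have hny : (n : ℝ) = y ^ 8 := by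
    rw [hydef, ← Real.rpow_natCast, ← Real.rpow_mul (by positivity)]
    norm_num
  have hy0 : 0 < y := by linarith
  have ht : (n.sqrt.sqrt : ℝ) ≤ y ^ 2 := by
    have h1 := Nat.sqrt_le' n
    have h2 := Nat.sqrt_le' n.sqrt
    have h3 : n.sqrt.sqrt ^ 4 ≤ n := by
      calc n.sqrt.sqrt ^ 4 = (n.sqrt.sqrt ^ 2) ^ 2 := by ring
        _ ≤ n.sqrt ^ 2 := Nat.pow_le_pow_left h2 2
        _ ≤ n := h1
    have h4 : (n.sqrt.sqrt : ℝ) ^ 4 ≤ (y ^ 2) ^ 4 := by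
      calc (n.sqrt.sqrt : ℝ) ^ 4 ≤ n := by exact_mod_cast h3
        _ = (y ^ 2) ^ 4 := by rw [hny]; ring
    exact le_of_pow_le_pow_left₀ (by norm_num) (by positivity) h4
  have hlog : Real.log n ≤ 8 * y := by
    rw [hny, Real.log_pow]
    have := Real.log_le_self hy0.le
    push_cast
    linarith
  have hlog0 : 0 ≤ Real.log n := Real.log_nonneg (by linarith)
  have hsq : y ^ 4 / 2 ≤ √((n : ℝ) - 1) := by
    refine Real.le_sqrt_of_sq_le ?_
    calc (y ^ 4 / 2) ^ 2 = n / 4 := by rw [hny]; ring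
      _ ≤ n - 1 := by linarith
  simp only [Function.comp]
  rw [← Real.rpow_natCast, Real.rpow_def_of_pos (by linarith), ← Real.exp_add]
  refine Real.exp_le_exp.2 ?_
  push_cast
  have h1 : Real.log n * (n.sqrt.sqrt + 6) ≤ 8 * y * (y ^ 2 + 6) := by gcongr
  have h2 : y ^ 3 * 100 ≤ y ^ 4 := by
    rw [pow_succ y 3]
    exact mul_le_mul_of_nonneg_left hn (by positivity)
  have h3 : y * 10000 ≤ y ^ 3 := by
    rw [show y ^ 3 = y * y ^ 2 by ring]
    exact mul_le_mul_of_nonneg_left (by nlinarith) hy0.le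
  nlinarith

lemma tendsto_pow_four_mul_pow :
    Tendsto (fun n : ℕ => (n : ℝ) ^ 4 * (63 / 64 : ℝ) ^ (n - 2)) atTop (nhds 0) := by
  have h := (tendsto_pow_const_mul_const_pow_of_abs_lt_one 4
    (r := (63 / 64 : ℝ)) (by norm_num [abs_lt])).mul_const ((63 / 64 : ℝ) ^ 2)⁻¹
  rw [zero_mul] at h
  refine h.congr' ?_
  filter_upwards [eventually_ge_atTop 2] with n hn
  rw [mul_assoc, pow_sub₀ _ (by norm_num) hn]

end Asymptotics

section UniformModel

open scoped Classical

variable {V : Type*} [Fintype V]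

lemma exists_edgeFinset_eq (E : Finset (Sym2 V)) (hE : ∀ e ∈ E, ¬ e.IsDiag) :
    ∃ G : SimpleGraph V, G.edgeFinset = E := by
  refine ⟨fromEdgeSet E, ?_⟩
  ext e
  simp only [mem_edgeFinset, edgeSet_fromEdgeSet, Set.mem_sdiff, Finset.mem_coe]
  exact ⟨fun h => h.1, fun h => ⟨h, by simpa using hE e h⟩⟩

lemma choose_le_card_edgeFinset_card_eq (m : ℕ) :
    ((Fintype.card V).choose 2).choose m ≤
      (Finset.univ.filter fun G : SimpleGraph V => G.edgeFinset.card = m).card := by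
  rw [← card_not_isDiag (V := V), ← Finset.card_powersetCard]
  refine Finset.card_le_card_of_surjOn (fun G => G.edgeFinset) fun E hE => ?_
  obtain ⟨hE, hm⟩ := Finset.mem_powersetCard.1 (Finset.mem_coe.1 hE)
  obtain ⟨G, rfl⟩ := exists_edgeFinset_eq E fun e he => by simpa using hE he
  exact ⟨G, by simpa using hm, rfl⟩

lemma exists_connected_card_edgeFinset_eq [Nonempty V] {m : ℕ} (h1 : Fintype.card V - 1 ≤ m)
    (h2 : m ≤ (Fintype.card V).choose 2) :
    ∃ G : SimpleGraph V, G.Connected ∧ G.edgeFinset.card = m := by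
  obtain ⟨T, -, hT⟩ := (connected_top (V := V)).exists_isTree_le
  have hc := hT.card_edgeFinset
  obtain ⟨E, hTE, hEU, hE⟩ := Finset.exists_subsuperset_card_eq T.edgeFinset_subset_not_isDiag
    (n := m) (by omega) (by rwa [card_not_isDiag])
  obtain ⟨G, rfl⟩ := exists_edgeFinset_eq E fun e he => by simpa using hEU he
  exact ⟨G, hT.connected.mono (edgeFinset_subset_edgeFinset.1 hTE), hE⟩

/-- The number of dense graphs with `m` edges that are disconnected or violate the strong
conjecture. -/
lemma card_not_strongConjectureHolds_le {m t : ℕ} (hn : 2 ≤ Fintype.card V)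
    (hm : m ≤ (Fintype.card V).choose 2)
    (hdense : Fintype.card V ^ 2 * (Fintype.card V - 1) ≤ 16 * m ^ 2)
    (ht : Fintype.card V ≤ t ^ 4)
    (hz : (Fintype.card V : ℝ) ^ (t + 1) *
      Real.exp (-(√((Fintype.card V : ℝ) - 1) / 4)) ≤ 1) :
    ((Finset.univ.filter fun G : SimpleGraph V => G.edgeFinset.card = m ∧
        ¬ (G.Connected ∧ G.StrongConjectureHolds)).card : ℝ) ≤
      ((Fintype.card V : ℝ) ^ (t + 5) * Real.exp (-(√((Fintype.card V : ℝ) - 1) / 4)) +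
        (Fintype.card V : ℝ) ^ 4 * (63 / 64) ^ (Fintype.card V - 2)) *
        ((Fintype.card V).choose 2).choose m := by
  have hne : Nonempty V := Fintype.card_pos_iff.1 (by omega)
  set n := Fintype.card V with hndef
  set N := n.choose 2 with hN
  have hNeven := Nat.div_two_mul_two_of_even (Nat.even_mul_pred_self n)
  rw [← Nat.choose_two_right, ← hN] at hNeven
  have hNpos : 0 < N := Nat.choose_pos hn
  have hnR : (2 : ℝ) ≤ n := by exact_mod_cast hn
  have hNR : (N : ℝ) * 2 = n * (n - 1) := by
    rw [← Nat.cast_one (R := ℝ), ← Nat.cast_sub (by omega : 1 ≤ n)]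
    exact_mod_cast hNeven
  set p : ℝ := m / N with hp
  have hNR0 : (0 : ℝ) < N := by exact_mod_cast hNpos
  have hp0 : 0 ≤ p := by positivity
  have hp1 : p ≤ 1 := (div_le_one hNR0).2 (by exact_mod_cast hm)
  set x := Real.exp (-(√((n : ℝ) - 1) / 4)) with hx
  have hexp : Real.exp (-(p * n / 2)) ≤ x := by
    refine Real.exp_le_exp.2 (neg_le_neg ?_)
    have h1 : p * n / 2 = m / (n - 1) := by
      have : (n : ℝ) - 1 ≠ 0 := by linarith
      rw [hp, show (N : ℝ) = n * (n - 1) / 2 by linarith]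
      field_simp
    have h2 : √((n : ℝ) - 1) * (n - 1) ≤ 4 * m := by
      refine le_of_pow_le_pow_left₀ two_ne_zero (by positivity) ?_
      rw [mul_pow, Real.sq_sqrt (by linarith)]
      have : (n : ℝ) ^ 2 * (n - 1) ≤ 16 * m ^ 2 := by
        rw [← Nat.cast_one (R := ℝ), ← Nat.cast_sub (by omega : 1 ≤ n)]
        exact_mod_cast hdense
      nlinarith
    rw [h1, le_div_iff₀ (by linarith)]
    linarith
  set Y : SimpleGraph V → Prop := fun G =>
    N ≤ 8 * m ∧ ∃ u v, u ≠ v ∧ ∀ w, ¬ (G.Adj u w ∧ G.Adj v w) with hY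
  have hprob : graphProb p (fun G : SimpleGraph V => ¬ (G.Connected ∧ G.StrongConjectureHolds) ∧
      G.edgeFinset.card = m) ≤ n * (n ^ (t + 1) * x) + n ^ 2 * (63 / 64) ^ (n - 2) := by
    have hX : graphProb p (HasBadSet t : SimpleGraph V → Prop) ≤ n * (n ^ (t + 1) * x) := by
      have hzz : (n : ℝ) ^ (t + 1) * Real.exp (-(p * n / 2)) ≤ n ^ (t + 1) * x := by gcongr
      exact (graphProb_hasBadSet_le hp0 hp1 (hzz.trans hz)).trans (by gcongr)
    have hYp : graphProb p Y ≤ n ^ 2 * (63 / 64) ^ (n - 2) := by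
      by_cases h8 : N ≤ 8 * m
      · have hp8 : 1 / 8 ≤ p := by
          rw [hp, le_div_iff₀ hNR0]
          have : (N : ℝ) ≤ 8 * m := by exact_mod_cast h8
          linarith
        refine (graphProb_le_sum hp0 hp1 (Finset.univ : Finset V).offDiag
          (fun q G => ∀ w, ¬ (G.Adj q.1 w ∧ G.Adj q.2 w)) fun G hG => ?_).trans ?_
        · obtain ⟨-, u, v, huv, h⟩ := hG
          exact ⟨(u, v), by simpa using huv, h⟩
        · refine (Finset.sum_le_card_nsmul _ _ ((63 / 64) ^ (n - 2)) fun q hq => ?_).trans ?_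
          · refine (graphProb_no_common_neighbor_le hp0 hp1 (by simpa using hq)).trans ?_
            exact pow_le_pow_left₀ (by nlinarith) (by nlinarith) _
          · rw [nsmul_eq_mul, Finset.offDiag_card, Finset.card_univ, ← hndef]
            gcongr
            rw [sq]
            exact_mod_cast Nat.sub_le _ _
      · have : graphProb p Y = 0 := by simp [graphProb, hY, h8]
        rw [this]
        positivity
    refine (graphProb_le_sum hp0 hp1 (Finset.univ : Finset Bool)
      (fun b => if b then HasBadSet t else Y) fun G hG => ?_).trans ?_
    · by_contra! hcon
      have h1 : ¬ G.HasBadSet t := by simpa using hcon true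
      have h2 : ¬ Y G := by simpa using hcon false
      have hc := connected_of_not_hasBadSet h1 ht
      refine hG.1 ⟨hc, ?_⟩
      rcases lt_or_ge (m * 8) N with h8 | h8
      · exact strongConjectureHolds_of_not_hasBadSet h1 ht (by rwa [hG.2])
      · refine strongConjectureHolds_of_common_neighbors hc fun u v huv => ?_
        by_contra! hw
        exact h2 ⟨by omega, u, v, huv, fun w hh => hw w hh.1 hh.2⟩
    · simpa using add_le_add hX hYp
  have hcard := card_le_mul_graphProb (fun G : SimpleGraph V =>
    ¬ (G.Connected ∧ G.StrongConjectureHolds) ∧ G.edgeFinset.card = m) hNpos hm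
  have hN1 : (N : ℝ) + 1 ≤ n ^ 2 := by nlinarith
  calc _ ≤ ((N : ℝ) + 1) * N.choose m * graphProb p (fun G : SimpleGraph V =>
        ¬ (G.Connected ∧ G.StrongConjectureHolds) ∧ G.edgeFinset.card = m) := by
        refine le_trans (Nat.cast_le.2 (Finset.card_le_card fun G hG => ?_)) hcard
        simp only [Finset.mem_filter, Finset.mem_univ, true_and] at hG ⊢
        exact ⟨hG.1, hG.2, hG.1⟩
    _ ≤ (n ^ 2 * N.choose m) * (n * (n ^ (t + 1) * x) + n ^ 2 * (63 / 64) ^ (n - 2)) := by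
        have hx0 : 0 ≤ x := (Real.exp_pos _).le
        refine mul_le_mul ?_ hprob (graphProb_nonneg hp0 hp1 _) (by positivity)
        gcongr
    _ ≤ _ := by
        have hx0 : 0 ≤ x := (Real.exp_pos _).le
        have h1 : (n : ℝ) ^ 2 * (n * (n ^ (t + 1) * x)) ≤ n ^ (t + 5) * x := by
          calc (n : ℝ) ^ 2 * (n * (n ^ (t + 1) * x)) = n ^ (t + 4) * x := by ring
            _ ≤ _ := by
              refine mul_le_mul_of_nonneg_right ?_ hx0
              exact pow_le_pow_right₀ (by linarith) (by omega)
        calc _ = (n ^ 2 * (n * (n ^ (t + 1) * x)) + (n : ℝ) ^ 4 * (63 / 64) ^ (n - 2)) *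
              N.choose m := by ring
          _ ≤ _ := by gcongr

lemma card_not_strongConjectureHolds_le_mul {ε : ℝ} (hε : 0 < ε) {t : ℕ}
    (hn : 2 ≤ Fintype.card V) (ht : Fintype.card V ≤ t ^ 4)
    (hδ : (Fintype.card V : ℝ) ^ (t + 5) * Real.exp (-(√((Fintype.card V : ℝ) - 1) / 4)) +
      (Fintype.card V : ℝ) ^ 4 * (63 / 64) ^ (Fintype.card V - 2) ≤ min (1 / 2) (ε / 2)) (m : ℕ) :
    ((Finset.univ.filter fun G : SimpleGraph V => G.edgeFinset.card = m ∧
        G.Connected ∧ ¬ G.StrongConjectureHolds).card : ℝ) ≤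
      ε * (Finset.univ.filter fun G : SimpleGraph V => G.edgeFinset.card = m ∧
        G.Connected).card := by
  rcases lt_or_ge (16 * m ^ 2) (Fintype.card V ^ 2 * (Fintype.card V - 1)) with hs | hs
  · rw [Finset.filter_false_of_mem, Finset.card_empty, Nat.cast_zero]
    · positivity
    · rintro G - ⟨hGm, hG, hn⟩
      exact hn (hG.strongConjectureHolds_of_sparse (by rwa [hGm]))
  by_cases hm : m ≤ (Fintype.card V).choose 2
  swap
  · rw [Finset.filter_false_of_mem, Finset.card_empty, Nat.cast_zero]
    · positivity
    · rintro G - ⟨hGm, -⟩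
      exact hm (hGm ▸ G.card_edgeFinset_le_choose)
  have hδ1 := hδ.trans (min_le_left _ _)
  have hδ2 := hδ.trans (min_le_right _ _)
  have hnR : (1 : ℝ) ≤ Fintype.card V := by exact_mod_cast (by omega : 1 ≤ Fintype.card V)
  have hz : (Fintype.card V : ℝ) ^ (t + 1) *
      Real.exp (-(√((Fintype.card V : ℝ) - 1) / 4)) ≤ 1 := by
    have h1 : (Fintype.card V : ℝ) ^ (t + 1) * Real.exp (-(√((Fintype.card V : ℝ) - 1) / 4)) ≤
        (Fintype.card V : ℝ) ^ (t + 5) * Real.exp (-(√((Fintype.card V : ℝ) - 1) / 4)) :=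
      mul_le_mul_of_nonneg_right (pow_le_pow_right₀ hnR (by omega)) (Real.exp_pos _).le
    have h2 : (0 : ℝ) ≤ (Fintype.card V : ℝ) ^ 4 * (63 / 64 : ℝ) ^ (Fintype.card V - 2) := by
      positivity
    linarith
  have key := card_not_strongConjectureHolds_le hn hm hs ht hz
  have htot : ((((Fintype.card V).choose 2).choose m : ℕ) : ℝ) ≤
      (Finset.univ.filter fun G : SimpleGraph V => G.edgeFinset.card = m ∧ G.Connected).card +
      (Finset.univ.filter fun G : SimpleGraph V => G.edgeFinset.card = m ∧
        ¬ (G.Connected ∧ G.StrongConjectureHolds)).card := by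
    refine (Nat.cast_le.2 (choose_le_card_edgeFinset_card_eq m)).trans ?_
    rw [← Nat.cast_add]
    refine Nat.cast_le.2 ((Finset.card_le_card fun G hG => ?_).trans (Finset.card_union_le _ _))
    simp only [Finset.mem_union, Finset.mem_filter, Finset.mem_univ, true_and] at hG ⊢
    tauto
  have hbad : ((Finset.univ.filter fun G : SimpleGraph V => G.edgeFinset.card = m ∧
        G.Connected ∧ ¬ G.StrongConjectureHolds).card : ℝ) ≤
      (Finset.univ.filter fun G : SimpleGraph V => G.edgeFinset.card = m ∧
        ¬ (G.Connected ∧ G.StrongConjectureHolds)).card := by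
    refine Nat.cast_le.2 (Finset.card_le_card fun G hG => ?_)
    simp only [Finset.mem_filter, Finset.mem_univ, true_and] at hG ⊢
    tauto
  generalize (Fintype.card V : ℝ) ^ (t + 5) * Real.exp (-(√((Fintype.card V : ℝ) - 1) / 4)) +
      (Fintype.card V : ℝ) ^ 4 * (63 / 64) ^ (Fintype.card V - 2) = δ at *
  have hC : (0 : ℝ) ≤ (((Fintype.card V).choose 2).choose m : ℕ) := Nat.cast_nonneg _
  generalize ((((Fintype.card V).choose 2).choose m : ℕ) : ℝ) = C at *
  have h4 : δ * C ≤ 1 / 2 * C := mul_le_mul_of_nonneg_right hδ1 hC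
  have h5 : δ * C ≤ ε / 2 * C := mul_le_mul_of_nonneg_right hδ2 hC
  have h6 : ε / 2 * C ≤ ε / 2 * (2 * (Finset.univ.filter fun G : SimpleGraph V =>
      G.edgeFinset.card = m ∧ G.Connected).card) :=
    mul_le_mul_of_nonneg_left (by linarith) (by positivity)
  linarith

/-- Almost all connected graphs with `m` edges satisfy the strong conjecture, uniformly in `m`. -/
lemma eventually_card_not_strongConjectureHolds_le {ε : ℝ} (hε : 0 < ε) :
    ∀ᶠ n : ℕ in Filter.atTop, ∀ (V : Type) [Fintype V], Fintype.card V = n → ∀ m : ℕ,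
      ((Finset.univ.filter fun G : SimpleGraph V => G.edgeFinset.card = m ∧
        G.Connected ∧ ¬ G.StrongConjectureHolds).card : ℝ) ≤
      ε * (Finset.univ.filter fun G : SimpleGraph V => G.edgeFinset.card = m ∧
        G.Connected).card := by
  have hδ := tendsto_pow_sqrt_sqrt_mul_exp.add tendsto_pow_four_mul_pow
  rw [add_zero] at hδ
  filter_upwards [Filter.eventually_ge_atTop 2, hδ.eventually_le_const
    (show 0 < min (1 / 2) (ε / 2) by positivity)] with n hn hδn V _ hV m
  subst hV
  exact card_not_strongConjectureHolds_le_mul hε hn (le_sqrt_sqrt_add_one_pow_four _) hδn m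

end UniformModel

section Measure

open scoped Classical

open MeasureTheory ProbabilityTheory Filter

instance instMeasurableSingletonClass {V : Type*} [Countable V] :
    MeasurableSingletonClass (SimpleGraph V) where
  measurableSet_singleton G := by
    have : {G} = (Adj : SimpleGraph V → V → V → Prop) ⁻¹' {G.Adj} := by
      ext H
      exact ⟨fun h => congrArg Adj h, fun h => SimpleGraph.ext h⟩
    rw [this]
    exact measurable_adj (measurableSet_singleton _)

lemma measure_eq_sum_card {V : Type*} [Fintype V] (μ : Measure (SimpleGraph V))
    (φ : ℕ → ENNReal) (hμ : ∀ G, μ {G} = φ G.edgeFinset.card) (Q : SimpleGraph V → Prop) :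
    μ {G | Q G} = ∑ m ∈ Finset.range ((Fintype.card V).choose 2 + 1),
      φ m * (Finset.univ.filter fun G : SimpleGraph V => G.edgeFinset.card = m ∧ Q G).card := by
  have h1 : {G | Q G} = ((Finset.univ.filter Q : Finset (SimpleGraph V)) : Set _) := by
    ext
    simp
  rw [h1, ← sum_measure_singleton, ← Finset.sum_fiberwise_of_maps_to
    (t := Finset.range ((Fintype.card V).choose 2 + 1))
    (g := fun G : SimpleGraph V => G.edgeFinset.card)]
  · refine Finset.sum_congr rfl fun m _ => ?_
    rw [Finset.filter_filter, Finset.sum_congr rfl (g := fun _ => φ m)]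
    · rw [Finset.sum_const, nsmul_eq_mul, mul_comm]
      simp only [and_comm]
    · intro G hG
      rw [hμ, (Finset.mem_filter.1 hG).2.2]
  · intro G _
    simpa [Nat.lt_succ_iff] using G.card_edgeFinset_le_choose

lemma measure_le_mul_of_card_le {V : Type*} [Fintype V] (μ : Measure (SimpleGraph V))
    (φ : ℕ → ENNReal) (hμ : ∀ G, μ {G} = φ G.edgeFinset.card) (Q R : SimpleGraph V → Prop)
    (r : NNReal) (h : ∀ m : ℕ,
      ((Finset.univ.filter fun G : SimpleGraph V => G.edgeFinset.card = m ∧ Q G).card : ℝ) ≤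
      r * (Finset.univ.filter fun G : SimpleGraph V => G.edgeFinset.card = m ∧ R G).card) :
    μ {G | Q G} ≤ r * μ {G | R G} := by
  rw [measure_eq_sum_card μ φ hμ, measure_eq_sum_card μ φ hμ, Finset.mul_sum]
  refine Finset.sum_le_sum fun m _ => ?_
  rw [mul_left_comm]
  refine mul_le_mul_right ?_ _
  have h' : ((Finset.univ.filter fun G : SimpleGraph V =>
      G.edgeFinset.card = m ∧ Q G).card : NNReal) ≤
      r * (Finset.univ.filter fun G : SimpleGraph V => G.edgeFinset.card = m ∧ R G).card := by
    rw [← NNReal.coe_le_coe]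
    push_cast
    exact h m
  exact_mod_cast ENNReal.coe_le_coe.2 h'

lemma ncard_edgeSet_eq {V : Type*} [Fintype V] (G : SimpleGraph V) :
    G.edgeSet.ncard = G.edgeFinset.card := by
  rw [← coe_edgeFinset, Set.ncard_coe_finset]

lemma ncard_edgeSet_top {V : Type*} [Fintype V] :
    (⊤ : SimpleGraph V).edgeSet.ncard = (Fintype.card V).choose 2 := by
  rw [edgeSet_top, ← card_not_isDiag, ← Set.ncard_coe_finset]
  congr 1
  ext e
  simp

/-- The strong conjecture holds with high probability for every conditioned random graph model in
which graphs with equally many edges are equally likely. -/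
lemma tendsto_cond_strongConjectureHolds (μ : ∀ n : ℕ, Measure (SimpleGraph (Fin n)))
    [∀ n, IsFiniteMeasure (μ n)] (φ : ℕ → ℕ → ENNReal)
    (hμ : ∀ n G, μ n {G} = φ n G.edgeSet.ncard)
    (hpos : ∀ᶠ n in atTop, ∃ G : SimpleGraph (Fin n), G.Connected ∧ μ n {G} ≠ 0) :
    Tendsto (fun n : ℕ => cond (μ n) {G : SimpleGraph (Fin n) | G.Connected}
      {G : SimpleGraph (Fin n) | G.StrongConjectureHolds}) atTop (nhds 1) := by
  have hmeas : ∀ (n : ℕ) (s : Set (SimpleGraph (Fin n))), MeasurableSet s :=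
    fun n s => s.toFinite.measurableSet
  have h0 : Tendsto (fun n : ℕ => cond (μ n) {G : SimpleGraph (Fin n) | G.Connected}
      {G : SimpleGraph (Fin n) | G.StrongConjectureHolds}ᶜ) atTop (nhds 0) := by
    rw [ENNReal.tendsto_nhds_zero]
    intro ε hε
    obtain ⟨r, hr, hrε⟩ := ENNReal.lt_iff_exists_nnreal_btwn.1 hε
    have hr' : (0 : ℝ) < r := by exact_mod_cast hr
    filter_upwards [eventually_card_not_strongConjectureHolds_le hr', hpos] with n hn hp
    obtain ⟨G₀, hG₀, hG₀'⟩ := hp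
    refine le_trans ?_ hrε.le
    rw [cond_apply (hmeas n _)]
    have hC0 : μ n {G | G.Connected} ≠ 0 := fun h =>
      hG₀' (measure_mono_null (Set.singleton_subset_iff.2 hG₀) h)
    have hle : μ n ({G | G.Connected} ∩ {G | G.StrongConjectureHolds}ᶜ) ≤
        r * μ n {G | G.Connected} := by
      refine measure_le_mul_of_card_le (μ n) (φ n) (fun G => ?_)
        (fun G => G.Connected ∧ ¬ G.StrongConjectureHolds) _ r fun m => by
          convert hn (Fin n) (Fintype.card_fin n) m
      rw [hμ, ncard_edgeSet_eq]
    calc _ ≤ (μ n {G | G.Connected})⁻¹ * (r * μ n {G | G.Connected}) :=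
          mul_le_mul_right hle _
      _ = r := by
          rw [mul_left_comm, ENNReal.inv_mul_cancel hC0 (measure_ne_top _ _), mul_one]
  have h1 := ENNReal.Tendsto.sub (tendsto_const_nhds (x := (1 : ENNReal))) h0 (by simp)
  rw [tsub_zero] at h1
  refine h1.congr' ?_
  filter_upwards [hpos] with n hp
  obtain ⟨G₀, hG₀, hG₀'⟩ := hp
  have hC0 : μ n {G | G.Connected} ≠ 0 := fun h =>
    hG₀' (measure_mono_null (Set.singleton_subset_iff.2 hG₀) h)
  have := cond_isProbabilityMeasure hC0
  rw [prob_compl_eq_one_sub (hmeas n _), ENNReal.sub_sub_cancel ENNReal.one_ne_top prob_le_one]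

lemma uniformRandom_singleton {n m : ℕ} (G : SimpleGraph (Fin n)) :
    uniformRandom n m {G} = if G.edgeSet.ncard = m then
      (Measure.count {G : SimpleGraph (Fin n) | G.edgeSet.ncard = m})⁻¹ else 0 := by
  rw [uniformRandom, uniformOn, cond_apply (Set.toFinite _).measurableSet]
  split_ifs with h
  · rw [Set.inter_eq_right.2 (by simpa using h), Measure.count_singleton,
      mul_one]
  · rw [Set.inter_singleton_eq_empty.2 (by simpa using h), measure_empty,
      mul_zero]

end Measure

end SimpleGraph

/-- For every sequence of edge probabilities `p n ∈ (0,1]`, and for every sequence of edge numbers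
`m n` for which connected graphs with `n` vertices and `m n` edges exist, the random graph `G(n,p)`,
respectively `G(n,m)`, conditioned on being connected, satisfies the strong conjecture with
probability tending to `1`. -/
theorem mainTheorem6 :
    (∀ p : ℕ → unitInterval, (∀ᶠ n in Filter.atTop, 0 < p n) →
      Filter.Tendsto
        (fun n : ℕ =>
          ProbabilityTheory.cond (SimpleGraph.binomialRandom (Fin n) (p n))
            {G : SimpleGraph (Fin n) | G.Connected}
            {G : SimpleGraph (Fin n) | G.StrongConjectureHolds})
        Filter.atTop (nhds 1)) ∧
    (∀ m : ℕ → ℕ, (∀ᶠ n in Filter.atTop, n - 1 ≤ m n ∧ m n ≤ n.choose 2) →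
      Filter.Tendsto
        (fun n : ℕ =>
          ProbabilityTheory.cond (SimpleGraph.uniformRandom n (m n))
            {G : SimpleGraph (Fin n) | G.Connected}
            {G : SimpleGraph (Fin n) | G.StrongConjectureHolds})
        Filter.atTop (nhds 1)) := by
  constructor
  · intro p hp
    refine SimpleGraph.tendsto_cond_strongConjectureHolds
      (fun n => SimpleGraph.binomialRandom (Fin n) (p n))
      (fun n k => unitInterval.toNNReal (p n) ^ k *
        unitInterval.toNNReal (unitInterval.symm (p n)) ^ (n.choose 2 - k)) ?_ ?_
    · intro n G
      rw [SimpleGraph.binomialRandom_singleton, Nat.card_fin]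
    · filter_upwards [hp, Filter.eventually_ge_atTop 1] with n hpn hn
      have : Nonempty (Fin n) := ⟨⟨0, hn⟩⟩
      refine ⟨⊤, SimpleGraph.connected_top, ?_⟩
      rw [SimpleGraph.binomialRandom_singleton, SimpleGraph.ncard_edgeSet_top, Nat.card_fin,
        Fintype.card_fin, Nat.sub_self,
        pow_zero, mul_one]
      refine pow_ne_zero _ fun h => ?_
      exact hpn.ne' (Subtype.ext (congrArg NNReal.toReal (ENNReal.coe_eq_zero.1 h)))
  · intro m hm
    have : ∀ n, MeasureTheory.IsFiniteMeasure (SimpleGraph.uniformRandom n (m n)) := fun n => by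
      unfold SimpleGraph.uniformRandom
      infer_instance
    refine SimpleGraph.tendsto_cond_strongConjectureHolds
      (fun n => SimpleGraph.uniformRandom n (m n))
      (fun n k => if k = m n then (MeasureTheory.Measure.count
        {G : SimpleGraph (Fin n) | G.edgeSet.ncard = m n})⁻¹ else 0)
      (fun n G => SimpleGraph.uniformRandom_singleton G) ?_
    filter_upwards [hm, Filter.eventually_ge_atTop 1] with n hmn hn
    have : Nonempty (Fin n) := ⟨⟨0, hn⟩⟩
    obtain ⟨G, hG, hGm⟩ := SimpleGraph.exists_connected_card_edgeFinset_eq (V := Fin n) (m := m n)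
      (by simpa using hmn.1) (by simpa using hmn.2)
    refine ⟨G, hG, ?_⟩
    rw [SimpleGraph.uniformRandom_singleton, SimpleGraph.ncard_edgeSet_eq, if_pos hGm,
      ENNReal.inv_ne_zero]
    exact (MeasureTheory.Measure.count_apply_lt_top.2 (Set.toFinite _)).ne
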